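/- Let $K$ be an algebraically closed field. (1) Suppose that $K$ has characteristic $0$. Let $n, r, k \ge 0$ be integers with $k < n$, let $X \subset \mathbb{P}^n$ be an irreducible Zariski-closed subset of dimension $r$, and let $L \subset \mathbb{P}^n$ be a linear subspace of dimension $k$. For $p \in X$ let $T_pX \subset \mathbb{P}^n$ denote the embedded projective tangent space of $X$ at $p$, that is, the linear subspace of $\mathbb{P}^n$ consisting of the one-dimensional subspaces of the Zariski tangent space, at any point $q \neq 0$ over $p$, of the affine cone over $X$ in $K^{n+1}$. Suppose that there is a dense (relatively) open subset $U_0$ of $X$ such that $\dim(L \cap T_pX) \ge r-1$ for all $p \in U_0$, where $\dim \emptyset = -1$. Then there is a linear subspace $M \subset \mathbb{P}^n$ of dimension $k+1$ such that $L \subset M$ and $X \subset M$. (2) The assumption on the characteristic cannot be dropped: if $K$ has characteristic $p > 0$, then there are an irreducible Zariski-closed subset $X \subset \mathbb{P}^3$ of dimension $1$ and a point $L \in \mathbb{P}^3$ such that $L \in T_qX$ for all $q$ in some dense open subset of $X$, while $X$ is contained in no line through $L$. -/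

import Mathlib

open MvPolynomial
open scoped LinearAlgebra.Projectivization

noncomputable section

/-- Projective `n`-space over `K`: the one-dimensional subspaces of `K ^ (n + 1)`. -/
abbrev PSpace (K : Type*) [Field K] (n : ℕ) : Type _ := ℙ K (Fin (n + 1) → K)

namespace PSpace

/-- The common zeros in projective space of a set of polynomials. It is only used for homogeneous
polynomials, where the choice of the representative `p.rep` is immaterial
(see `mk_mem_zeros_iff`). -/
def zeros {K : Type*} [Field K] {n : ℕ} (S : Set (MvPolynomial (Fin (n + 1)) K)) :
    Set (PSpace K n) :=
  {p | ∀ f ∈ S, eval p.rep f = 0}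

theorem eval_smul_of_isHomogeneous {K : Type*} [Field K] {σ : Type*} {d : ℕ}
    {f : MvPolynomial σ K} (hf : f.IsHomogeneous d) (c : K) (v : σ → K) :
    eval (c • v) f = c ^ d * eval v f := by
  rw [eval_eq, eval_eq, Finset.mul_sum]
  refine Finset.sum_congr rfl fun m hm => ?_
  have hd : ∑ i ∈ m.support, m i = d := by
    have h := hf (mem_support_iff.1 hm)
    rw [Finsupp.weight_apply, Finsupp.sum] at h
    simpa using h
  simp only [Pi.smul_apply, smul_eq_mul, mul_pow, Finset.prod_mul_distrib,
    Finset.prod_pow_eq_pow_sum, hd]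
  ring

theorem mk_mem_zeros_iff {K : Type*} [Field K] {n : ℕ}
    {S : Set (MvPolynomial (Fin (n + 1)) K)} (hS : ∀ f ∈ S, ∃ d : ℕ, f.IsHomogeneous d)
    (v : Fin (n + 1) → K) (hv : v ≠ 0) :
    (Projectivization.mk K v hv : PSpace K n) ∈ zeros S ↔ ∀ f ∈ S, eval v f = 0 := by
  obtain ⟨a, ha⟩ := Projectivization.exists_smul_eq_mk_rep K v hv
  refine forall₂_congr fun f hf => ?_
  obtain ⟨d, hd⟩ := hS f hf
  rw [← ha, Units.smul_def, eval_smul_of_isHomogeneous hd]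
  simp

/-- The Zariski topology: the closed sets are the common zeros of sets of homogeneous
polynomials. -/
instance zariskiTopology (K : Type*) [Field K] (n : ℕ) : TopologicalSpace (PSpace K n) :=
  TopologicalSpace.ofClosed
    {Z | ∃ S : Set (MvPolynomial (Fin (n + 1)) K),
      (∀ f ∈ S, ∃ d : ℕ, f.IsHomogeneous d) ∧ Z = zeros S}
    ⟨{1}, by
      rintro f rfl
      exact ⟨0, isHomogeneous_one _ _⟩, by
      ext p
      simp [zeros]⟩
    (by
      intro A hA
      refine ⟨{f | ∃ S : Set (MvPolynomial (Fin (n + 1)) K),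
        (∀ g ∈ S, ∃ d : ℕ, g.IsHomogeneous d) ∧ zeros S ∈ A ∧ f ∈ S}, ?_, ?_⟩
      · rintro f ⟨S, hS, -, hf⟩
        exact hS f hf
      · ext p
        constructor
        · rintro hp f ⟨S, -, hSA, hf⟩
          exact hp _ hSA f hf
        · intro hp Z hZ
          obtain ⟨S, hS, rfl⟩ := hA hZ
          exact fun f hf => hp f ⟨S, hS, hZ, hf⟩)
    (by
      rintro _ ⟨S, hS, rfl⟩ _ ⟨T, hT, rfl⟩
      refine ⟨{f | ∃ g ∈ S, ∃ h ∈ T, f = g * h}, ?_, ?_⟩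
      · rintro f ⟨g, hg, h, hh, rfl⟩
        obtain ⟨d, hd⟩ := hS g hg
        obtain ⟨e, he⟩ := hT h hh
        exact ⟨d + e, hd.mul he⟩
      · ext p
        constructor
        · rintro (hp | hp) f ⟨g, hg, h, hh, rfl⟩
          · rw [map_mul, hp g hg, zero_mul]
          · rw [map_mul, hp h hh, mul_zero]
        · intro hp
          by_contra hne
          rw [Set.mem_union, not_or] at hne
          obtain ⟨h1, h2⟩ := hne
          simp only [zeros, Set.mem_ofPred_eq, not_forall] at h1 h2
          obtain ⟨g, hg, hg0⟩ := h1
          obtain ⟨h, hh, hh0⟩ := h2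
          have := hp (g * h) ⟨g, hg, h, hh, rfl⟩
          rw [map_mul] at this
          exact (mul_ne_zero hg0 hh0) this)

theorem isClosed_iff {K : Type*} [Field K] {n : ℕ} {Z : Set (PSpace K n)} :
    IsClosed Z ↔ ∃ S : Set (MvPolynomial (Fin (n + 1)) K),
      (∀ f ∈ S, ∃ d : ℕ, f.IsHomogeneous d) ∧ Z = zeros S := by
  rw [← isOpen_compl_iff]
  change Zᶜᶜ ∈ _ ↔ _
  rw [compl_compl]
  rfl

/-- The dimension of a linear subspace of a projective space, equal to `-1` for the empty one. -/
def linDim {K : Type*} [Field K] {n : ℕ} (L : Projectivization.Subspace K (Fin (n + 1) → K)) : ℤ :=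
  (Module.finrank K (Projectivization.Subspace.submodule L) : ℤ) - 1

/-- The affine cone over a subset of projective space. -/
def affineCone {K : Type*} [Field K] {n : ℕ} (X : Set (PSpace K n)) : Set (Fin (n + 1) → K) :=
  {v | ∀ hv : v ≠ 0, Projectivization.mk K v hv ∈ X}

/-- The Zariski tangent space, inside `K ^ σ`, of a subset `C` of affine space at a point `q`: the
common kernel of the differentials at `q` of all the polynomials vanishing on `C`. -/
def zariskiTangentSpace {K : Type*} [Field K] {σ : Type*} [Fintype σ] (C : Set (σ → K))
    (q : σ → K) : Submodule K (σ → K) where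
  carrier := {w | ∀ f ∈ vanishingIdeal K C, ∑ i, eval q (pderiv i f) * w i = 0}
  zero_mem' := by
    intro f _
    simp
  add_mem' := by
    intro a b ha hb f hf
    simp only [Pi.add_apply, mul_add, Finset.sum_add_distrib, ha f hf, hb f hf, add_zero]
  smul_mem' := by
    intro c a ha f hf
    have h : ∀ i, eval q (pderiv i f) * (c • a) i = c * (eval q (pderiv i f) * a i) := by
      intro i
      rw [Pi.smul_apply, smul_eq_mul]
      ring
    simp only [h, ← Finset.mul_sum, ha f hf, mul_zero]

/-- The embedded projective tangent space of `X` at `p`: the linear space of the lines through the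
origin in the Zariski tangent space of the affine cone at a point over `p`. The choice of that
point is immaterial (see `embeddedTangentSpace_mk`). -/
def embeddedTangentSpace {K : Type*} [Field K] {n : ℕ} (X : Set (PSpace K n)) (p : PSpace K n) :
    Projectivization.Subspace K (Fin (n + 1) → K) :=
  Projectivization.Subspace.submodule.symm (zariskiTangentSpace (affineCone X) p.rep)

theorem pderiv_scale {K : Type*} [Field K] {σ : Type*} (c : K) (i : σ) (f : MvPolynomial σ K) :
    pderiv i (bind₁ (fun j => C c * X j) f) =
      C c * bind₁ (fun j => C c * X j) (pderiv i f) := by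
  classical
  induction f using MvPolynomial.induction_on with
  | C a => simp
  | add f g hf hg => simp only [map_add, hf, hg, mul_add]
  | mul_X f j hf =>
    simp only [map_mul, bind₁_X_right, Derivation.leibniz, hf, smul_eq_mul, map_add, pderiv_X,
      pderiv_C, mul_zero, add_zero]
    rcases eq_or_ne j i with rfl | hij
    · simp
      ring
    · simp [hij]
      ring

theorem zariskiTangentSpace_le_smul {K : Type*} [Field K] {n : ℕ} (X : Set (PSpace K n))
    (c : K) (hc : c ≠ 0) (q : Fin (n + 1) → K) :
    zariskiTangentSpace (affineCone X) q ≤ zariskiTangentSpace (affineCone X) (c • q) := by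
  intro w hw f hf
  have ev : ∀ (v : Fin (n + 1) → K) (g : MvPolynomial (Fin (n + 1)) K),
      eval v (bind₁ (fun j => C c * MvPolynomial.X j) g) = eval (c • v) g := by
    intro v g
    rw [← coe_aeval_eq_eval, ← coe_aeval_eq_eval]
    change aeval v (bind₁ _ g) = aeval (c • v) g
    rw [aeval_bind₁]
    congr 2
    ext j
    simp
  have hg : bind₁ (fun j => C c * MvPolynomial.X j) f ∈ vanishingIdeal K (affineCone X) := by
    intro v hv
    change eval v _ = 0
    rw [ev]
    refine hf (c • v) fun h0 => ?_
    have hv0 : v ≠ 0 := right_ne_zero_of_smul h0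
    have : Projectivization.mk K (c • v) h0 = Projectivization.mk K v hv0 := by
      rw [Projectivization.mk_eq_mk_iff']
      exact ⟨c, rfl⟩
    rw [this]
    exact hv hv0
  have h := hw _ hg
  simp only [pderiv_scale, map_mul, eval_C, ev, mul_assoc, ← Finset.mul_sum] at h
  exact (mul_eq_zero.1 h).resolve_left hc

theorem embeddedTangentSpace_mk {K : Type*} [Field K] {n : ℕ} (X : Set (PSpace K n))
    (q : Fin (n + 1) → K) (hq : q ≠ 0) :
    embeddedTangentSpace X (Projectivization.mk K q hq) =
      Projectivization.Subspace.submodule.symm (zariskiTangentSpace (affineCone X) q) := by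
  obtain ⟨a, ha⟩ := Projectivization.exists_smul_eq_mk_rep K q hq
  unfold embeddedTangentSpace
  congr 1
  rw [← ha]
  refine le_antisymm ?_ (zariskiTangentSpace_le_smul X (a : K) a.ne_zero q)
  have h := zariskiTangentSpace_le_smul X ((a⁻¹ : Kˣ) : K) (a⁻¹).ne_zero (a • q)
  rw [← Units.smul_def, inv_smul_smul] at h
  exact h

end PSpace

end

/-! For (1), let `W` be the vector subspace defining `L`. It is enough that on `X` every linear form
`ψ` vanishing on `W` is a scalar multiple of any such form `φ` that is not identically zero there:
the cone over `X` then lies in `W` plus one line. This proportionality is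
`exists_apply_eq_mul_apply`. To prove it, pass to the affine variety `φ = 1` in the cone, with
coordinate ring `A`, on which `ψ` is a function `t`. If `t` is not constant, it is transcendental
over the algebraically closed field `K`, so it extends by some of the coordinates to a transcendence
basis `u` of `A`, and `u` has at most `r` elements. In characteristic zero every coordinate is a
simple root of a polynomial over `K[u]` at a general point `q`, so a tangent vector at `q` is
determined by its values on `u`. A vector of `W` tangent to the cone at `q` is killed by `φ`, hence
tangent to the patch, and by `ψ`, hence zero on `t`. Such vectors thus depend on at most `r - 1`
parameters, whereas the hypothesis gives them vector space dimension at least `r`. For (2), the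
curve `y ^ p = z x ^ (p - 1)` works: in characteristic `p` the term `y ^ p` has zero differential,
so the `y`-direction is tangent wherever `x ≠ 0`. -/

/-! ### Commutative algebra: dimension, transcendence degree and simple roots -/

/-- An integral extension of domains does not have smaller Krull dimension than its base. -/
theorem ringKrullDim_le_of_isIntegral_of_injective {R S : Type*} [CommRing R] [CommRing S]
    [IsDomain R] [IsDomain S] [Algebra R S] [Algebra.IsIntegral R S]
    (hinj : Function.Injective (algebraMap R S)) : ringKrullDim R ≤ ringKrullDim S := by
  have hup : Algebra.HasGoingUp R S := by
    refine ⟨fun {q} hq P hP hlt => ?_⟩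
    obtain ⟨Q, hPQ, hQ, hQq⟩ :=
      Ideal.exists_ideal_over_prime_of_isIntegral_of_isPrime q P hlt.le
    exact ⟨Q, hPQ, hQ, ⟨hQq.symm⟩⟩
  refine iSup_le fun l => ?_
  -- Lying over lifts the smallest prime of the chain; going up then lifts the rest to a chain of
  -- the same length.
  obtain ⟨Q, -, hQ, hQl⟩ := Ideal.exists_ideal_over_prime_of_isIntegral (S := S)
    l.head.asIdeal ⊥ (by
      rw [← RingHom.ker_eq_comap_bot, (RingHom.injective_iff_ker_eq_bot _).1 hinj]
      exact bot_le)
  have : Q.LiesOver (RelSeries.head l).asIdeal := ⟨hQl.symm⟩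
  obtain ⟨L, hL, -⟩ := Ideal.exists_ltSeries_of_hasGoingUp l Q
  rw [← hL]
  exact Order.LTSeries.length_le_krullDim L

/-- The transcendence degree of an affine domain is at most its Krull dimension. -/
theorem IsTranscendenceBasis.natCard_le_ringKrullDim {k R ι : Type*} [Field k] [CommRing R]
    [IsDomain R] [Algebra k R] [Algebra.FiniteType k R] {x : ι → R}
    (hx : IsTranscendenceBasis k x) : (Nat.card ι : WithBot ℕ∞) ≤ ringKrullDim R := by
  -- By Noether normalization the ring is integral over a polynomial ring in `s` variables, which
  -- form another transcendence basis; so `s` is the cardinality of `ι`.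
  obtain ⟨s, g, hg, hint⟩ := exists_integral_inj_algHom_of_fg k R
  let := g.toRingHom.toAlgebra
  have : IsScalarTower k (MvPolynomial (Fin s) k) R :=
    IsScalarTower.of_algebraMap_eq fun r => (g.commutes r).symm
  have : Algebra.IsIntegral (MvPolynomial (Fin s) k) R := ⟨hint⟩
  have : FaithfulSMul (MvPolynomial (Fin s) k) R :=
    (faithfulSMul_iff_algebraMap_injective _ _).2 hg
  have hb := (IsTranscendenceBasis.mvPolynomial (Fin s) k).algebraMap_comp (A := R)
  have hcard := congrArg Cardinal.toNat (hx.lift_cardinalMk_eq hb)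
  simp only [Cardinal.toNat_lift, Cardinal.mk_fin, Cardinal.toNat_natCast] at hcard
  have hs : Nat.card ι = s := hcard
  calc (Nat.card ι : WithBot ℕ∞) = ringKrullDim (MvPolynomial (Fin s) k) := by
        rw [MvPolynomial.ringKrullDim_of_isNoetherianRing, ringKrullDim_eq_zero_of_field, hs]
        simp
    _ ≤ ringKrullDim R := ringKrullDim_le_of_isIntegral_of_injective hg

/-- An algebraic element over a domain of characteristic zero is a simple root of some
polynomial. -/
theorem IsAlgebraic.exists_aeval_derivative_ne_zero {R S : Type*} [CommRing R] [CommRing S]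
    [IsDomain R] [CharZero R] [Algebra R S] (hinj : Function.Injective (algebraMap R S)) {x : S}
    (hx : IsAlgebraic R x) :
    ∃ p : Polynomial R, Polynomial.aeval x p = 0 ∧
      Polynomial.aeval x (Polynomial.derivative p) ≠ 0 := by
  classical
  -- Take an annihilating polynomial of least degree. Its derivative is nonzero in characteristic
  -- zero and of smaller degree, so it cannot annihilate `x`.
  have hex : ∃ d : ℕ, ∃ p : Polynomial R, p ≠ 0 ∧ Polynomial.aeval x p = 0 ∧ p.natDegree = d := by
    obtain ⟨p, hp, hpx⟩ := hx
    exact ⟨_, p, hp, hpx, rfl⟩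
  obtain ⟨p, hp, hpx, hpd⟩ := Nat.find_spec hex
  refine ⟨p, hpx, fun h => ?_⟩
  have hd : p.natDegree ≠ 0 := by
    intro h0
    rw [Polynomial.eq_C_of_natDegree_eq_zero h0] at hp hpx
    rw [Polynomial.aeval_C, map_eq_zero_iff _ hinj] at hpx
    exact hp (by rw [hpx, map_zero])
  have hne : Polynomial.derivative p ≠ 0 := fun h0 =>
    hd (Polynomial.derivative_eq_zero.1 h0)
  exact Nat.find_min hex (hpd ▸ Polynomial.natDegree_derivative_lt hd) ⟨_, hne, h, rfl⟩

/-- A homomorphism to the dual numbers, trivial to first order on a subalgebra, is trivial to first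
order at every point that is a simple root over that subalgebra. -/
theorem DualNumber.snd_eq_zero_of_aeval_eq_zero {K A : Type*} [Field K] [CommRing A] [Algebra K A]
    (Φ : A →ₐ[K] DualNumber K) (R : Subalgebra K A)
    (hR : ∀ y ∈ R, TrivSqZeroExt.snd (Φ y) = 0) {x : A} {p : Polynomial R}
    (hp : Polynomial.aeval x p = 0)
    (hp' : TrivSqZeroExt.fst (Φ (Polynomial.aeval x (Polynomial.derivative p))) ≠ 0) :
    TrivSqZeroExt.snd (Φ x) = 0 := by
  let π : DualNumber K →+* K := (TrivSqZeroExt.fstHom K K K : DualNumber K →+* K)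
  let ι : K →+* DualNumber K := TrivSqZeroExt.inlHom K K
  let g : R →+* DualNumber K := (Φ : A →+* DualNumber K).comp (algebraMap R A)
  let f : R →+* K := π.comp g
  -- Triviality on `R` means that `Φ` maps the coefficients into the scalars `K`.
  have hg : g = ι.comp f := by
    ext y
    · rfl
    · exact hR y y.2
  have hΦ : ∀ q : Polynomial R, Φ (Polynomial.aeval x q) = (q.map g).eval (Φ x) := by
    intro q
    rw [Polynomial.aeval_def, Polynomial.eval_map]
    exact Polynomial.hom_eval₂ q (algebraMap R A) (Φ : A →+* DualNumber K) x
  have hx : Φ x = ι (π (Φ x)) + TrivSqZeroExt.inr (TrivSqZeroExt.snd (Φ x)) :=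
    (TrivSqZeroExt.inl_fst_add_inr_snd_eq (Φ x)).symm
  have hι : ∀ q : Polynomial R, (q.map g).eval (ι (π (Φ x))) = ι ((q.map f).eval (π (Φ x))) := by
    intro q
    rw [hg, ← Polynomial.map_map, Polynomial.eval_map_apply]
  have hc : TrivSqZeroExt.fst (Φ (Polynomial.aeval x (Polynomial.derivative p))) =
      ((Polynomial.derivative p).map f).eval (π (Φ x)) := by
    rw [hΦ]
    change π _ = _
    rw [← Polynomial.eval_map_apply, Polynomial.map_map]
  have h0 : Φ (Polynomial.aeval x p) = 0 := by rw [hp, map_zero]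
  -- Taylor expansion: with `Φ x = c + s ε`, the relation `p(Φ x) = 0` has `ε`-part `p'(c) s`, and
  -- `p'(c) ≠ 0`.
  rw [hΦ, hx, Polynomial.eval_add_of_sq_eq_zero _ _ _ (by
    rw [pow_two]; exact TrivSqZeroExt.inr_mul_inr _ _ _), hι, Polynomial.derivative_map, hι] at h0
  have h1 := congrArg TrivSqZeroExt.snd h0
  rw [hc] at hp'
  simpa [ι, hp'] using h1

/-! ### Homogenization and the affine patches of the cone -/

noncomputable section

namespace PSpace

variable {K : Type*} [Field K]

/-- The linear form on `K ^ σ`, as a polynomial. -/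
def linForm {σ : Type*} [Fintype σ] [DecidableEq σ] (φ : Module.Dual K (σ → K)) :
    MvPolynomial σ K :=
  ∑ i, C (φ (Pi.single i 1)) * X i

section linForm

variable {σ : Type*} [Fintype σ] [DecidableEq σ] (φ : Module.Dual K (σ → K))

@[simp]
theorem eval_linForm (v : σ → K) : eval v (linForm φ) = φ v := by
  conv_rhs => rw [pi_eq_sum_univ' v]
  simp [linForm, mul_comm]

theorem isHomogeneous_linForm : (linForm φ).IsHomogeneous 1 := by
  refine IsHomogeneous.sum _ _ _ fun i _ => ?_
  simpa using (isHomogeneous_C σ (φ (Pi.single i 1))).mul (isHomogeneous_X K i)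

end linForm

/-- Homogenization with respect to a form `ℓ` of degree one: every polynomial is congruent modulo
`ℓ - 1` to a homogeneous multiple of `ℓ`. -/
theorem exists_isHomogeneous_eq_add_mul {σ : Type*} {ℓ : MvPolynomial σ K}
    (hℓ : ℓ.IsHomogeneous 1) (f : MvPolynomial σ K) :
    ∃ (d : ℕ) (F h : MvPolynomial σ K), F.IsHomogeneous d ∧ F = f + (ℓ - 1) * h ∧ ℓ ∣ F := by
  induction f using MvPolynomial.induction_on with
  | C a =>
    -- The constant itself is homogeneous, but the extra factor `ℓ` makes the result vanish also
    -- where `ℓ = 0`, in particular at the origin, which belongs to every affine cone.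
    refine ⟨1, ℓ * C a, C a, ?_, by ring, dvd_mul_right _ _⟩
    simpa using hℓ.mul (isHomogeneous_C σ a)
  | add f g hf hg =>
    obtain ⟨d, F, h, hF, hFf, hℓF⟩ := hf
    obtain ⟨e, G, k, hG, hGg, hℓG⟩ := hg
    -- Powers of `ℓ` equalize the two degrees, and change nothing modulo `ℓ - 1`.
    obtain ⟨u, hu⟩ := sub_one_dvd_pow_sub_one ℓ e
    obtain ⟨w, hw⟩ := sub_one_dvd_pow_sub_one ℓ d
    refine ⟨d + e, ℓ ^ e * F + ℓ ^ d * G, h + u * F + k + w * G, ?_, ?_,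
      dvd_add (hℓF.mul_left _) (hℓG.mul_left _)⟩
    · refine IsHomogeneous.add ?_ ?_
      · simpa [add_comm] using (hℓ.pow e).mul hF
      · simpa using (hℓ.pow d).mul hG
    · linear_combination hFf + hGg + F * hu + G * hw
  | mul_X f i hf =>
    obtain ⟨d, F, h, hF, hFf, hℓF⟩ := hf
    exact ⟨d + 1, F * X i, h * X i, hF.mul (isHomogeneous_X K i),
      by rw [hFf]; ring, hℓF.mul_right _⟩

variable {n : ℕ}

theorem isClosed_zeros_singleton {d : ℕ} {F : MvPolynomial (Fin (n + 1)) K}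
    (hF : F.IsHomogeneous d) : IsClosed (zeros {F} : Set (PSpace K n)) :=
  isClosed_iff.2 ⟨{F}, by rintro f rfl; exact ⟨d, hF⟩, rfl⟩

theorem mk_mem_zeros_singleton_iff {d : ℕ} {F : MvPolynomial (Fin (n + 1)) K}
    (hF : F.IsHomogeneous d) (v : Fin (n + 1) → K) (hv : v ≠ 0) :
    (Projectivization.mk K v hv : PSpace K n) ∈ zeros {F} ↔ eval v F = 0 := by
  rw [mk_mem_zeros_iff (by rintro f rfl; exact ⟨d, hF⟩)]
  simp

theorem smul_mem_affineCone {X : Set (PSpace K n)} {v : Fin (n + 1) → K} (hv : v ∈ affineCone X)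
    (c : K) : c • v ∈ affineCone X := by
  intro hcv
  have hv0 : v ≠ 0 := right_ne_zero_of_smul hcv
  have : Projectivization.mk K (c • v) hcv = Projectivization.mk K v hv0 := by
    rw [Projectivization.mk_eq_mk_iff']
    exact ⟨c, rfl⟩
  rw [this]
  exact hv hv0

theorem subset_zeros_singleton_iff {X : Set (PSpace K n)} {d : ℕ}
    {F : MvPolynomial (Fin (n + 1)) K} (hF : F.IsHomogeneous d) :
    X ⊆ zeros {F} ↔ ∀ v ∈ affineCone X, v ≠ 0 → eval v F = 0 := by
  constructor
  · intro h v hv hv0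
    exact (mk_mem_zeros_singleton_iff hF v hv0).1 (h (hv hv0))
  · intro h p hp
    induction p using Projectivization.ind with
    | h v hv => exact (mk_mem_zeros_singleton_iff hF v hv).2 (h v (fun _ => hp) hv)

theorem subset_or_subset_of_eval_mul {X : Set (PSpace K n)} (hX : IsIrreducible X) {d e : ℕ}
    {F G : MvPolynomial (Fin (n + 1)) K} (hF : F.IsHomogeneous d) (hG : G.IsHomogeneous e)
    (h : ∀ v ∈ affineCone X, v ≠ 0 → eval v F * eval v G = 0) :
    (∀ v ∈ affineCone X, v ≠ 0 → eval v F = 0) ∨ ∀ v ∈ affineCone X, v ≠ 0 → eval v G = 0 := by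
  rw [← subset_zeros_singleton_iff hF, ← subset_zeros_singleton_iff hG]
  refine isPreirreducible_iff_isClosed_union_isClosed.1 hX.isPreirreducible _ _
    (isClosed_zeros_singleton hF) (isClosed_zeros_singleton hG) fun p hp => ?_
  induction p using Projectivization.ind with
  | h v hv =>
    exact (mul_eq_zero.1 (h v (fun _ => hp) hv)).imp
      (mk_mem_zeros_singleton_iff hF v hv).2 (mk_mem_zeros_singleton_iff hG v hv).2

/-- The part of the affine cone over `X` on which the linear form `φ` is one: a copy of the affine
variety `X \ {φ = 0}`. -/
def patch (X : Set (PSpace K n)) (φ : Module.Dual K (Fin (n + 1) → K)) : Set (Fin (n + 1) → K) :=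
  {v | φ v = 1 ∧ v ∈ affineCone X}

variable {X : Set (PSpace K n)} {φ : Module.Dual K (Fin (n + 1) → K)}

theorem ne_zero_of_apply_eq_one {v : Fin (n + 1) → K} (hv : φ v = 1) : v ≠ 0 := by
  rintro rfl
  simp at hv

theorem eval_eq_zero_of_mem_vanishingIdeal_patch {d : ℕ} {F : MvPolynomial (Fin (n + 1)) K}
    (hF : F.IsHomogeneous d) (h : F ∈ vanishingIdeal K (patch X φ)) {v : Fin (n + 1) → K}
    (hv : v ∈ affineCone X) (hφ : φ v ≠ 0) : eval v F = 0 := by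
  have h1 : eval ((φ v)⁻¹ • v) F = 0 := h _ ⟨by simp [hφ], smul_mem_affineCone hv _⟩
  rw [eval_smul_of_isHomogeneous hF] at h1
  simpa [hφ] using h1

/-- A homogeneous multiple of the linear form `φ` vanishing on the patch vanishes on the cone. -/
theorem mem_vanishingIdeal_affineCone {d : ℕ} {F : MvPolynomial (Fin (n + 1)) K}
    (hF : F.IsHomogeneous d) (hφF : linForm φ ∣ F) (h : F ∈ vanishingIdeal K (patch X φ)) :
    F ∈ vanishingIdeal K (affineCone X) := by
  intro v hv
  change eval v F = 0
  by_cases hφ : φ v = 0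
  · obtain ⟨G, rfl⟩ := hφF
    simp [hφ]
  · exact eval_eq_zero_of_mem_vanishingIdeal_patch hF h hv hφ

/-- The product of `F` and the linear form vanishes on the whole cone; by irreducibility one factor
does, and it is not the linear form. -/
theorem eval_eq_zero_of_isIrreducible (hX : IsIrreducible X) (hφ : ∃ v ∈ affineCone X, φ v ≠ 0)
    {d : ℕ} {F : MvPolynomial (Fin (n + 1)) K} (hF : F.IsHomogeneous d)
    (h : F ∈ vanishingIdeal K (patch X φ)) {v : Fin (n + 1) → K} (hv : v ∈ affineCone X)
    (hv0 : v ≠ 0) : eval v F = 0 := by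
  rcases subset_or_subset_of_eval_mul hX hF (isHomogeneous_linForm φ) (fun w hw _ => by
    by_cases hw0 : φ w = 0
    · simp [hw0]
    · rw [eval_eq_zero_of_mem_vanishingIdeal_patch hF h hw hw0, zero_mul]) with h1 | h1
  · exact h1 v hv hv0
  · obtain ⟨w, hw, hw0⟩ := hφ
    refine absurd ?_ hw0
    have := h1 w hw (by rintro rfl; simp at hw0)
    simpa using this

theorem eval_eq_of_eq_add_mul {F f h : MvPolynomial (Fin (n + 1)) K}
    (hF : F = f + (linForm φ - 1) * h) {v : Fin (n + 1) → K} (hv : φ v = 1) :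
    eval v F = eval v f := by
  simp [hF, hv]

/-- Homogenizing two factors leaves their values on the patch unchanged, so primality reduces to the
irreducibility of `X` tested on forms. -/
theorem isPrime_vanishingIdeal_patch (hX : IsIrreducible X) (hφ : ∃ v ∈ affineCone X, φ v ≠ 0) :
    (vanishingIdeal K (patch X φ)).IsPrime := by
  refine ⟨?_, ?_⟩
  · rw [Ideal.ne_top_iff_one]
    intro h
    obtain ⟨v, hv, hv0⟩ := hφ
    have := h ((φ v)⁻¹ • v) ⟨by simp [hv0], smul_mem_affineCone hv _⟩
    simp at this
  · intro f g hfg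
    obtain ⟨d, F, h, hF, hFf, -⟩ := exists_isHomogeneous_eq_add_mul (isHomogeneous_linForm φ) f
    obtain ⟨e, G, k, hG, hGg, -⟩ := exists_isHomogeneous_eq_add_mul (isHomogeneous_linForm φ) g
    have hFG : F * G ∈ vanishingIdeal K (patch X φ) := by
      intro v hv
      change eval v (F * G) = 0
      rw [map_mul, eval_eq_of_eq_add_mul hFf hv.1, eval_eq_of_eq_add_mul hGg hv.1, ← map_mul]
      exact hfg v hv
    refine (subset_or_subset_of_eval_mul hX hF hG fun v hv hv0 => ?_).imp ?_ ?_
    · rw [← map_mul]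
      exact eval_eq_zero_of_isIrreducible hX hφ (hF.mul hG) hFG hv hv0
    · intro h1 v hv
      change eval v f = 0
      rw [← eval_eq_of_eq_add_mul hFf hv.1]
      exact h1 v hv.2 (ne_zero_of_apply_eq_one hv.1)
    · intro h1 v hv
      change eval v g = 0
      rw [← eval_eq_of_eq_add_mul hGg hv.1]
      exact h1 v hv.2 (ne_zero_of_apply_eq_one hv.1)

/-- A polynomial that does not vanish on the patch does not vanish at some point of the patch over
a given open set meeting `X`. -/
theorem exists_mem_patch_eval_ne_zero (hX : IsIrreducible X)
    (hφ : ∃ v ∈ affineCone X, φ v ≠ 0) {U : Set (PSpace K n)} (hU : IsOpen U)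
    (hXU : (X ∩ U).Nonempty) {g : MvPolynomial (Fin (n + 1)) K}
    (hg : g ∉ vanishingIdeal K (patch X φ)) :
    ∃ q ∈ patch X φ, ∃ hq : q ≠ 0, Projectivization.mk K q hq ∈ U ∧ eval q g ≠ 0 := by
  -- One form `h` among the equations of the complement of `U` is nonzero somewhere on `X`, so `g *
  -- h` is not in the prime ideal of the patch; a point where it is nonzero serves.
  obtain ⟨S, hS, hSU⟩ := isClosed_iff.1 hU.isClosed_compl
  obtain ⟨p, hpX, hpU⟩ := hXU
  obtain ⟨h, hhS, hh⟩ : ∃ h ∈ S, eval p.rep h ≠ 0 := by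
    by_contra! hc
    have : p ∈ Uᶜ := by rw [hSU]; exact hc
    exact this hpU
  obtain ⟨d, hd⟩ := hS h hhS
  have hhJ : h ∉ vanishingIdeal K (patch X φ) := fun hJ =>
    hh (eval_eq_zero_of_isIrreducible hX hφ hd hJ (fun hv => by rwa [p.mk_rep]) p.rep_nonzero)
  have hgh : g * h ∉ vanishingIdeal K (patch X φ) := fun hJ =>
    ((isPrime_vanishingIdeal_patch hX hφ).mem_or_mem hJ).elim hg hhJ
  simp only [mem_vanishingIdeal_iff, not_forall] at hgh
  obtain ⟨q, hq, hqgh⟩ := hgh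
  change ¬ eval q (g * h) = 0 at hqgh
  rw [map_mul, mul_eq_zero, not_or] at hqgh
  have hq0 := ne_zero_of_apply_eq_one hq.1
  refine ⟨q, hq, hq0, ?_, hqgh.1⟩
  by_contra hqU
  have : Projectivization.mk K q hq0 ∈ Uᶜ := hqU
  rw [hSU, mk_mem_zeros_iff hS] at this
  exact hqgh.2 (this h hhS)

end PSpace
end

/-! ### The dimension of a patch is at most that of `X` -/

noncomputable section

namespace PSpace

variable {K : Type*} [Field K] {n : ℕ} {X : Set (PSpace K n)}
  {φ : Module.Dual K (Fin (n + 1) → K)}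

/-- The points of `X` with a representative in `V`. -/
def pointsOver (X : Set (PSpace K n)) (V : Set (Fin (n + 1) → K)) : Set X :=
  {x | ∃ v ∈ V, ∃ hv : v ≠ 0, (x : PSpace K n) = Projectivization.mk K v hv}

theorem apply_eq_one_of_mem_zeroLocus {P : Ideal (MvPolynomial (Fin (n + 1)) K)}
    (hP : vanishingIdeal K (patch X φ) ≤ P) {v : Fin (n + 1) → K} (hv : v ∈ zeroLocus K P) :
    φ v = 1 := by
  have h : linForm φ - 1 ∈ vanishingIdeal K (patch X φ) := by
    intro w hw
    change eval w _ = 0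
    simp [hw.1]
  have h1 : eval v (linForm φ - 1) = 0 := hv _ (hP h)
  simpa [sub_eq_zero] using h1

theorem mk_mem_of_mem_zeroLocus (hX : IsClosed X) {P : Ideal (MvPolynomial (Fin (n + 1)) K)}
    (hP : vanishingIdeal K (patch X φ) ≤ P) {v : Fin (n + 1) → K} (hv : v ∈ zeroLocus K P)
    (hv0 : v ≠ 0) : (Projectivization.mk K v hv0 : PSpace K n) ∈ X := by
  obtain ⟨S, hS, rfl⟩ := isClosed_iff.1 hX
  rw [mk_mem_zeros_iff hS]
  intro f hf
  refine hv f (hP fun w hw => ?_)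
  exact (mk_mem_zeros_iff hS w (ne_zero_of_apply_eq_one hw.1)).1 (hw.2 _) f hf

variable [IsAlgClosed K]

/-- By the Nullstellensatz a polynomial outside `P` is nonzero somewhere on the zero locus of `P`,
so primality of `P` becomes irreducibility of the locus. -/
theorem isIrreducible_pointsOver (hX : IsClosed X) {P : Ideal (MvPolynomial (Fin (n + 1)) K)}
    (hP : vanishingIdeal K (patch X φ) ≤ P) [hPp : P.IsPrime] :
    IsIrreducible (pointsOver X (zeroLocus K P)) := by
  have hvan := IsPrime.vanishingIdeal_zeroLocus (K := K) P
  have hne : ∀ f ∉ P, ∃ v ∈ zeroLocus K P, ∃ hv : v ≠ 0, ∃ x ∈ pointsOver X (zeroLocus K P),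
      (x : PSpace K n) = Projectivization.mk K v hv ∧ eval v f ≠ 0 := by
    intro f hf
    rw [← hvan] at hf
    simp only [mem_vanishingIdeal_iff, not_forall] at hf
    obtain ⟨v, hv, hvf⟩ := hf
    have hv0 := ne_zero_of_apply_eq_one (apply_eq_one_of_mem_zeroLocus hP hv)
    exact ⟨v, hv, hv0, ⟨_, mk_mem_of_mem_zeroLocus hX hP hv hv0⟩, ⟨v, hv, hv0, rfl⟩, rfl, hvf⟩
  refine ⟨?_, isPreirreducible_iff_isClosed_union_isClosed.2 ?_⟩
  · obtain ⟨v, -, -, x, hx, -⟩ := hne 1 ((Ideal.ne_top_iff_one _).1 hPp.ne_top)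
    exact ⟨x, hx⟩
  · intro Z₁ Z₂ hZ₁ hZ₂ hsub
    -- A closed set missing some point of the locus lies, within the locus, in the zeros of a single
    -- form outside `P`.
    have key : ∀ Z : Set X, IsClosed Z → ¬ pointsOver X (zeroLocus K P) ⊆ Z →
        ∃ f ∉ P, ∀ (v : Fin (n + 1) → K) (hv : v ≠ 0), eval v f ≠ 0 →
          ∀ x : X, (x : PSpace K n) = Projectivization.mk K v hv → x ∉ Z := by
      intro Z hZ hnot
      obtain ⟨T, hT, rfl⟩ := isClosed_induced_iff.1 hZ
      obtain ⟨S, hS, rfl⟩ := isClosed_iff.1 hT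
      obtain ⟨x, ⟨v, hv, hv0, hxv⟩, hxS⟩ := Set.not_subset.1 hnot
      rw [Set.mem_preimage, hxv, mk_mem_zeros_iff hS] at hxS
      push Not at hxS
      obtain ⟨f, hf, hfv⟩ := hxS
      refine ⟨f, fun hfP => hfv (hv f hfP), fun w hw hfw y hy hyS => hfw ?_⟩
      rw [Set.mem_preimage, hy, mk_mem_zeros_iff hS] at hyS
      exact hyS f hf
    by_contra hcon
    rw [not_or] at hcon
    obtain ⟨f, hf, hfZ⟩ := key Z₁ hZ₁ hcon.1
    obtain ⟨g, hg, hgZ⟩ := key Z₂ hZ₂ hcon.2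
    obtain ⟨v, -, hv0, x, hx, hxv, hfg⟩ := hne (f * g) fun h => (hPp.mem_or_mem h).elim hf hg
    rw [map_mul] at hfg
    exact (hsub hx).elim (hfZ v hv0 (left_ne_zero_of_mul hfg) x hxv)
      (hgZ v hv0 (right_ne_zero_of_mul hfg) x hxv)

/-- The homogenization of an element of `Q` cuts out a projective closed set containing the locus of
`Q`, hence that of `P`; the Nullstellensatz brings the element back into `P`. -/
theorem le_of_closure_pointsOver_subset (hX : IsClosed X)
    {P Q : Ideal (MvPolynomial (Fin (n + 1)) K)} [P.IsPrime]
    (hP : vanishingIdeal K (patch X φ) ≤ P) (hQ : vanishingIdeal K (patch X φ) ≤ Q)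
    (h : closure (pointsOver X (zeroLocus K P)) ⊆ closure (pointsOver X (zeroLocus K Q))) :
    Q ≤ P := by
  intro f hf
  obtain ⟨d, F, k, hF, hFf, -⟩ := exists_isHomogeneous_eq_add_mul (isHomogeneous_linForm φ) f
  have hclosed : IsClosed (Subtype.val ⁻¹' (zeros {F} : Set (PSpace K n)) : Set X) :=
    (isClosed_zeros_singleton hF).preimage continuous_subtype_val
  have hsub : closure (pointsOver X (zeroLocus K Q)) ⊆ Subtype.val ⁻¹' zeros {F} := by
    refine closure_minimal ?_ hclosed
    rintro x ⟨v, hv, hv0, hxv⟩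
    rw [Set.mem_preimage, hxv, mk_mem_zeros_singleton_iff hF,
      eval_eq_of_eq_add_mul hFf (apply_eq_one_of_mem_zeroLocus hQ hv)]
    exact hv f hf
  rw [← IsPrime.vanishingIdeal_zeroLocus (K := K) P]
  intro v hv
  change eval v f = 0
  have hφv := apply_eq_one_of_mem_zeroLocus hP hv
  have hv0 := ne_zero_of_apply_eq_one hφv
  let x : X := ⟨Projectivization.mk K v hv0, mk_mem_of_mem_zeroLocus hX hP hv hv0⟩
  have hx : x ∈ pointsOver X (zeroLocus K P) := ⟨v, hv, hv0, rfl⟩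
  have hxF : x ∈ Subtype.val ⁻¹' (zeros {F} : Set (PSpace K n)) := hsub (h (subset_closure hx))
  rw [← eval_eq_of_eq_add_mul hFf hφv]
  exact (mk_mem_zeros_singleton_iff hF v hv0).1 hxF

theorem ringKrullDim_le_topologicalKrullDim (hX : IsClosed X) :
    ringKrullDim (MvPolynomial (Fin (n + 1)) K ⧸ vanishingIdeal K (patch X φ)) ≤
      topologicalKrullDim X := by
  let J := vanishingIdeal K (patch X φ)
  let pull : PrimeSpectrum (MvPolynomial (Fin (n + 1)) K ⧸ J) →
      Ideal (MvPolynomial (Fin (n + 1)) K) := fun P => P.asIdeal.comap (Ideal.Quotient.mk J)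
  have hpull : ∀ P, J ≤ pull P := fun P f hf => by
    change Ideal.Quotient.mk J f ∈ P.asIdeal
    rw [Ideal.Quotient.eq_zero_iff_mem.2 hf]
    exact zero_mem _
  have hprime : ∀ P, (pull P).IsPrime := fun P => P.2.comap _
  have hle : ∀ P Q, pull P ≤ pull Q → P ≤ Q := fun P Q h =>
    (Ideal.comap_le_comap_iff_of_surjective _ Ideal.Quotient.mk_surjective _ _).1 h
  -- Larger primes have smaller loci, hence the order dual.
  let W : (PrimeSpectrum (MvPolynomial (Fin (n + 1)) K ⧸ J))ᵒᵈ →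
      TopologicalSpace.IrreducibleCloseds X := fun P =>
    ⟨closure (pointsOver X (zeroLocus K (pull (OrderDual.ofDual P)))),
      (isIrreducible_iff_closure).2
        (isIrreducible_pointsOver hX (hpull _) (hPp := hprime _)), isClosed_closure⟩
  have hW : StrictMono W := by
    intro P Q hPQ
    have hlt : OrderDual.ofDual Q < OrderDual.ofDual P := hPQ
    refine lt_of_le_not_ge (closure_mono ?_) fun hge => ?_
    · rintro x ⟨v, hv, hv0, hxv⟩
      exact ⟨v, zeroLocus_anti_mono (Ideal.comap_mono hlt.le) hv, hv0, hxv⟩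
    · have := hprime (OrderDual.ofDual Q)
      exact hlt.not_ge (hle _ _ (le_of_closure_pointsOver_subset hX (hpull _) (hpull _) hge))
  calc ringKrullDim (MvPolynomial (Fin (n + 1)) K ⧸ J)
      = Order.krullDim (PrimeSpectrum (MvPolynomial (Fin (n + 1)) K ⧸ J))ᵒᵈ :=
        Order.krullDim_orderDual.symm
    _ ≤ topologicalKrullDim X := Order.krullDim_le_of_strictMono W hW

end PSpace
end

/-! ### Tangent vectors as dual numbers, and proportionality of linear forms -/

noncomputable section

namespace PSpace

variable {K : Type*} [Field K]

/-- The first-order expansion at `q` in the direction `w`. -/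
def expansion {σ : Type*} (q w : σ → K) : MvPolynomial σ K →ₐ[K] DualNumber K :=
  aeval fun i => TrivSqZeroExt.inl (q i) + TrivSqZeroExt.inr (w i)

theorem fst_expansion {σ : Type*} (q w : σ → K) (f : MvPolynomial σ K) :
    TrivSqZeroExt.fst (expansion q w f) = eval q f := by
  induction f using MvPolynomial.induction_on with
  | C a => simp [expansion, ← algebraMap_eq, TrivSqZeroExt.algebraMap_eq_inl]
  | add f g hf hg => simp [hf, hg]
  | mul_X f i hf => simp [hf]; simp [expansion]

/-- Identifies the `ε`-part with the differential, so that tangent vectors become algebra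
homomorphisms to the dual numbers. -/
theorem snd_expansion {σ : Type*} [Fintype σ] (q w : σ → K) (f : MvPolynomial σ K) :
    TrivSqZeroExt.snd (expansion q w f) = ∑ i, eval q (pderiv i f) * w i := by
  classical
  induction f using MvPolynomial.induction_on with
  | C a => simp [expansion, ← algebraMap_eq, TrivSqZeroExt.algebraMap_eq_inl]
  | add f g hf hg => simp [hf, hg, add_mul, Finset.sum_add_distrib]
  | mul_X f i hf =>
    have h : expansion q w (X i) = TrivSqZeroExt.inl (q i) + TrivSqZeroExt.inr (w i) := by
      simp [expansion]
    have hj : ∀ j, eval q (pderiv j (f * X i)) * w j =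
        (if i = j then eval q f * w j else 0) + q i * (eval q (pderiv j f) * w j) := by
      intro j
      rw [Derivation.leibniz, pderiv_X]
      rcases eq_or_ne i j with rfl | hij
      · simp
        ring
      · simp [hij]
        ring
    rw [map_mul, TrivSqZeroExt.snd_mul, hf, fst_expansion, h, Finset.sum_congr rfl fun j _ => hj j,
      Finset.sum_add_distrib, ← Finset.mul_sum]
    simp [mul_comm]

variable {n : ℕ} {X : Set (PSpace K n)} {φ : Module.Dual K (Fin (n + 1) → K)}

theorem snd_expansion_linForm (q w : Fin (n + 1) → K) (ψ : Module.Dual K (Fin (n + 1) → K)) :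
    TrivSqZeroExt.snd (expansion q w (linForm ψ)) = ψ w := by
  conv_rhs => rw [pi_eq_sum_univ' w]
  simp [expansion, linForm, mul_comm, TrivSqZeroExt.snd_sum, TrivSqZeroExt.algebraMap_eq_inl]

/-- A vector tangent to the cone and killed by `φ` is tangent to the patch. -/
theorem expansion_eq_zero {q w : Fin (n + 1) → K} (hq : q ∈ patch X φ)
    (hw : w ∈ zariskiTangentSpace (affineCone X) q) (hφw : φ w = 0)
    {f : MvPolynomial (Fin (n + 1)) K} (hf : f ∈ vanishingIdeal K (patch X φ)) :
    expansion q w f = 0 := by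
  obtain ⟨d, F, h, hF, hFf, hdvd⟩ := exists_isHomogeneous_eq_add_mul (isHomogeneous_linForm φ) f
  have hFJ : F ∈ vanishingIdeal K (affineCone X) := by
    refine mem_vanishingIdeal_affineCone hF hdvd fun v hv => ?_
    change eval v F = 0
    rw [eval_eq_of_eq_add_mul hFf hv.1]
    exact hf v hv
  ext
  · rw [fst_expansion]
    exact hf q hq
  · have h1 : TrivSqZeroExt.snd (expansion q w F) = 0 := by
      rw [snd_expansion]
      exact hw F hFJ
    rw [hFf, map_add, map_mul, TrivSqZeroExt.snd_add, TrivSqZeroExt.snd_mul, map_sub, map_one,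
      TrivSqZeroExt.snd_sub, TrivSqZeroExt.fst_sub, fst_expansion, snd_expansion_linForm] at h1
    simpa [hq.1, hφw] using h1

variable [IsAlgClosed K]

/-- If `X` is irreducible of dimension at most `r` and a linear space cuts the tangent spaces of `X`
at the points of a nonempty open subset in dimension at least `r - 1`, then any two linear forms
vanishing on the linear space are proportional on `X`. -/
theorem exists_apply_eq_mul_apply [CharZero K] {r : ℕ} (hXc : IsClosed X) (hX : IsIrreducible X)
    (hdim : topologicalKrullDim X ≤ (r : WithBot ℕ∞)) (hφ : ∃ v ∈ affineCone X, φ v ≠ 0)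
    {L : Submodule K (Fin (n + 1) → K)} (hφL : ∀ v ∈ L, φ v = 0)
    {ψ : Module.Dual K (Fin (n + 1) → K)} (hψL : ∀ v ∈ L, ψ v = 0)
    {U : Set (PSpace K n)} (hU : IsOpen U) (hXU : (X ∩ U).Nonempty)
    (htan : ∀ (q : Fin (n + 1) → K) (hq : q ≠ 0), q ∈ affineCone X →
      Projectivization.mk K q hq ∈ U →
      r ≤ Module.finrank K (L ⊓ zariskiTangentSpace (affineCone X) q : Submodule K _)) :
    ∃ a : K, ∀ v ∈ affineCone X, ψ v = a * φ v := by
  classical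
  set J := vanishingIdeal K (patch X φ) with hJ
  have hJp : J.IsPrime := isPrime_vanishingIdeal_patch hX hφ
  let A := MvPolynomial (Fin (n + 1)) K ⧸ J
  let x : Fin (n + 1) → A := fun i => Ideal.Quotient.mk J (MvPolynomial.X i)
  let t : A := Ideal.Quotient.mk J (linForm ψ)
  by_cases ht : ∃ a : K, algebraMap K A a = t
  · obtain ⟨a, ha⟩ := ht
    refine ⟨a, fun v hv => ?_⟩
    have hmem : linForm ψ - C a * linForm φ ∈ J := by
      have h1 : linForm ψ - C a ∈ J := Ideal.Quotient.eq.1 ha.symm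
      intro w hw
      have := h1 w hw
      change eval w _ = 0 at this ⊢
      simpa [hw.1] using this
    have hhom : (linForm ψ - C a * linForm φ).IsHomogeneous 1 := by
      refine IsHomogeneous.sub (isHomogeneous_linForm ψ) ?_
      simpa using (isHomogeneous_C _ a).mul (isHomogeneous_linForm φ)
    rcases eq_or_ne v 0 with rfl | hv0
    · simp
    · have := eval_eq_zero_of_isIrreducible hX hφ hhom hmem hv hv0
      simpa [sub_eq_zero] using this
  exfalso
  have htr : Transcendental K t := fun halg =>
    ht (by
      have hint : IsIntegral K t := isAlgebraic_iff_isIntegral.1 halg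
      obtain ⟨a, ha⟩ := (IsAlgClosed.algebraMap_bijective_of_isIntegral
        (k := K) (K := integralClosure K A)).2 ⟨t, hint⟩
      exact ⟨a, congrArg Subtype.val ha⟩)
  have hadj : Algebra.adjoin K ({t} ∪ Set.range x) = ⊤ := by
    refine top_le_iff.1 ?_
    have : Algebra.adjoin K (Set.range x) = ⊤ := by
      have h1 := congrArg (Subalgebra.map (Ideal.Quotient.mkₐ K J))
        (adjoin_range_X (R := K) (σ := Fin (n + 1)))
      rw [AlgHom.map_adjoin, ← Set.range_comp, Algebra.map_top,
        (AlgHom.range_eq_top _).2 (Ideal.Quotient.mkₐ_surjective K J)] at h1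
      exact h1
    rw [← this]
    exact Algebra.adjoin_mono Set.subset_union_right
  have hindep : AlgebraicIndepOn K id ({t} : Set A) :=
    (algebraicIndependent_singleton_iff (⟨t, rfl⟩ : ({t} : Set A))).2 htr
  have hspan : Algebra.IsAlgebraic (Algebra.adjoin K ({t} ∪ Set.range x)) A := by
    refine ⟨fun a => ?_⟩
    exact isAlgebraic_algebraMap
      (⟨a, hadj ▸ Algebra.mem_top⟩ : Algebra.adjoin K ({t} ∪ Set.range x))
  -- The elements of `u` other than `t` are taken among the coordinates so that the derivative of
  -- each along `w` is an entry of `w`.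
  obtain ⟨u, htu, hux, hu⟩ := exists_isTranscendenceBasis_between {t} ({t} ∪ Set.range x)
    Set.subset_union_left hindep
  have hufin : u.Finite := ((Set.finite_singleton t).union (Set.finite_range x)).subset hux
  have := hufin.fintype
  have hcard : Fintype.card u ≤ r := by
    have h1 := hu.natCard_le_ringKrullDim.trans
      ((ringKrullDim_le_topologicalKrullDim hXc).trans hdim)
    rw [Nat.card_eq_fintype_card] at h1
    exact_mod_cast h1
  have hualg : Algebra.IsAlgebraic (Algebra.adjoin K u) A := by
    have := hu.isAlgebraic
    rwa [Subtype.range_val] at this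
  have hzero : CharZero (Algebra.adjoin K u) :=
    charZero_of_injective_algebraMap (algebraMap K (Algebra.adjoin K u)).injective
  have hsep : ∀ i, ∃ p : Polynomial (Algebra.adjoin K u), Polynomial.aeval (x i) p = 0 ∧
      Polynomial.aeval (x i) (Polynomial.derivative p) ≠ 0 := fun i =>
    (hualg.isAlgebraic (x i)).exists_aeval_derivative_ne_zero Subtype.val_injective
  choose p hp hp' using hsep
  -- Where `g ≠ 0`, all the coordinates are simple roots over `K[u]` at once.
  obtain ⟨g, hg⟩ := Ideal.Quotient.mk_surjective
    (∏ i, Polynomial.aeval (x i) (Polynomial.derivative (p i)))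
  have hgJ : g ∉ J := by
    rw [← Ideal.Quotient.eq_zero_iff_mem, hg]
    exact Finset.prod_ne_zero_iff.2 fun i _ => hp' i
  obtain ⟨q, hq, hq0, hqU, hqg⟩ := exists_mem_patch_eval_ne_zero hX hφ hU hXU hgJ
  have hrank := htan q hq0 hq.2 hqU
  have hidx : ∀ y : {y : u // (y : A) ≠ t}, ∃ i, x i = y := fun y =>
    (hux y.1.2).resolve_left y.2
  choose idx hidx using hidx
  let T : Submodule K (Fin (n + 1) → K) := L ⊓ zariskiTangentSpace (affineCone X) q
  -- `e` records the derivatives of the elements of `u` other than `t`; that of `t` itself is `ψ w =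
  -- 0`.
  let e : T →ₗ[K] ({y : u // (y : A) ≠ t} → K) :=
    LinearMap.funLeft K K idx ∘ₗ T.subtype
  have he : Function.Injective e := by
    rw [← LinearMap.ker_eq_bot, LinearMap.ker_eq_bot']
    rintro ⟨w, hw⟩ hew
    have hwi : ∀ y, w (idx y) = 0 := fun y => congrFun hew y
    have hΦ0 : ∀ f : MvPolynomial (Fin (n + 1)) K, f ∈ J → expansion q w f = 0 := fun f hf =>
      expansion_eq_zero hq hw.2 (hφL w hw.1) hf
    let Φ : A →ₐ[K] DualNumber K := Ideal.Quotient.liftₐ J (expansion q w) hΦ0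
    have hΦmk : ∀ f, Φ (Ideal.Quotient.mk J f) = expansion q w f := fun f => rfl
    have hΦx : ∀ i, TrivSqZeroExt.snd (Φ (x i)) = w i := fun i => by
      change TrivSqZeroExt.snd (expansion q w (MvPolynomial.X i)) = w i
      simp [expansion]
    have hR : ∀ y ∈ Algebra.adjoin K u, TrivSqZeroExt.snd (Φ y) = 0 := by
      intro y hy
      induction hy using Algebra.adjoin_induction with
      | mem y hy =>
        by_cases hyt : y = t
        · rw [hyt, hΦmk, snd_expansion_linForm]
          exact hψL w hw.1
        · have := hidx ⟨⟨y, hy⟩, hyt⟩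
          change x _ = y at this
          rw [← this, hΦx]
          exact hwi _
      | algebraMap a => simp [TrivSqZeroExt.algebraMap_eq_inl]
      | add a b _ _ ha hb => simp [ha, hb]
      | mul a b _ _ ha hb => simp [ha, hb]
    have hw0 : w = 0 := by
      funext i
      rw [← hΦx i]
      refine DualNumber.snd_eq_zero_of_aeval_eq_zero Φ _ hR (hp i) fun h0 => hqg ?_
      rw [← fst_expansion q w g, ← hΦmk, hg, map_prod]
      change TrivSqZeroExt.fstHom K K K _ = 0
      rw [map_prod]
      exact Finset.prod_eq_zero (Finset.mem_univ i) h0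
    exact Subtype.ext hw0
  have hfin := LinearMap.finrank_le_finrank_of_injective he
  rw [Module.finrank_fintype_fun_eq_card] at hfin
  have hlt : Fintype.card {y : u // (y : A) ≠ t} < Fintype.card u :=
    Fintype.card_subtype_lt (x := ⟨t, htu rfl⟩) (by simp)
  have : Module.finrank K T = Module.finrank K
    (L ⊓ zariskiTangentSpace (affineCone X) q : Submodule K _) := rfl
  omega

end PSpace
end

/-! ### From proportional linear forms to the subspace `M` -/

noncomputable section

namespace PSpace

variable {K : Type*} [Field K] {n : ℕ}

theorem submodule_inf_symm (L : Projectivization.Subspace K (Fin (n + 1) → K))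
    (T : Submodule K (Fin (n + 1) → K)) :
    Projectivization.Subspace.submodule (L ⊓ Projectivization.Subspace.submodule.symm T) =
      Projectivization.Subspace.submodule L ⊓ T := by
  ext v
  rcases eq_or_ne v 0 with rfl | hv
  · simp
  · rw [Submodule.mem_inf, Projectivization.Subspace.mem_submodule_iff _ hv,
      Projectivization.Subspace.mem_submodule_iff _ hv]
    exact Iff.rfl

theorem exists_subspace_of_le_linDim_tangent [IsAlgClosed K] [CharZero K] {X : Set (PSpace K n)}
    {r k : ℕ}
    {L : Projectivization.Subspace K (Fin (n + 1) → K)} (hk : k < n) (hXc : IsClosed X)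
    (hX : IsIrreducible X) (hdim : topologicalKrullDim X ≤ (r : WithBot ℕ∞))
    (hL : linDim L = (k : ℤ)) {U : Set (PSpace K n)} (hU : IsOpen U) (hXU : (X ∩ U).Nonempty)
    (htan : ∀ p ∈ X ∩ U, (r : ℤ) - 1 ≤ linDim (L ⊓ embeddedTangentSpace X p)) :
    ∃ M : Projectivization.Subspace K (Fin (n + 1) → K),
      linDim M = (k : ℤ) + 1 ∧ L ≤ M ∧ X ⊆ (M : Set (PSpace K n)) := by
  set W := Projectivization.Subspace.submodule L with hW
  have hWrank : Module.finrank K W = k + 1 := by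
    have h : (Module.finrank K W : ℤ) - 1 = k := hL
    omega
  have htan' : ∀ (q : Fin (n + 1) → K) (hq : q ≠ 0), q ∈ affineCone X →
      Projectivization.mk K q hq ∈ U →
      r ≤ Module.finrank K (W ⊓ zariskiTangentSpace (affineCone X) q : Submodule K _) := by
    intro q hq hqX hqU
    have h := htan _ ⟨hqX hq, hqU⟩
    rw [embeddedTangentSpace_mk, linDim, submodule_inf_symm] at h
    have h' : (r : ℤ) - 1 ≤
        (Module.finrank K (W ⊓ zariskiTangentSpace (affineCone X) q : Submodule K _) : ℤ) - 1 := h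
    omega
  have hprop := fun (φ ψ : Module.Dual K (Fin (n + 1) → K)) hφ hφW hψW =>
    exists_apply_eq_mul_apply (φ := φ) (ψ := ψ) hXc hX hdim hφ (L := W) hφW hψW hU hXU htan'
  -- `v₀` spans the extra direction of `M`. If the cone lies in `W`, any vector outside `W` will do,
  -- and `k < n` provides one.
  obtain ⟨v₀, hv₀, hXv₀⟩ : ∃ v₀, v₀ ∉ W ∧
      (v₀ ∈ affineCone X ∨ ∀ v ∈ affineCone X, v ∈ W) := by
    by_cases h : ∀ v ∈ affineCone X, v ∈ W
    · have hne : W ≠ ⊤ := by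
        intro h0
        rw [h0, finrank_top, Module.finrank_fintype_fun_eq_card, Fintype.card_fin] at hWrank
        omega
      obtain ⟨v₀, hv₀⟩ := SetLike.exists_not_mem_of_ne_top W hne rfl
      exact ⟨v₀, hv₀, Or.inr h⟩
    · push Not at h
      obtain ⟨v₀, hv₀X, hv₀⟩ := h
      exact ⟨v₀, hv₀, Or.inl hv₀X⟩
  refine ⟨Projectivization.Subspace.submodule.symm (W ⊔ Submodule.span K {v₀}), ?_, ?_, ?_⟩
  · rw [linDim, OrderIso.apply_symm_apply, Submodule.finrank_sup_span_singleton hv₀, hWrank]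
    push_cast
    ring
  · rw [OrderIso.le_symm_apply]
    exact le_sup_left
  · intro p hp
    induction p using Projectivization.ind with
    | h v hv =>
      have hvX : v ∈ affineCone X := fun _ => hp
      change v ∈ W ⊔ Submodule.span K {v₀}
      rcases hXv₀ with hv₀X | hXW
      · by_contra hvM
        -- If `v` were outside `M`, some `ψ` would vanish on `W` and `v₀` but not at `v`. Comparing
        -- with `φ` at `v₀` forces the factor to be zero, so `ψ v = 0`.
        obtain ⟨φ, hφv₀, hφW⟩ := Submodule.exists_le_ker_of_notMem hv₀
        obtain ⟨ψ, hψv, hψM⟩ := Submodule.exists_le_ker_of_notMem hvM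
        obtain ⟨a, ha⟩ := hprop φ ψ ⟨v₀, hv₀X, hφv₀⟩ (fun w hw => hφW hw)
          (fun w hw => hψM (le_sup_left (a := W) hw))
        have h0 : ψ v₀ = 0 :=
          hψM (le_sup_right (a := W) (Submodule.mem_span_singleton_self v₀))
        have ha0 : a = 0 := by
          rw [ha v₀ hv₀X] at h0
          exact (mul_eq_zero.1 h0).resolve_right hφv₀
        exact hψv (by rw [ha v hvX, ha0, zero_mul])
      · exact le_sup_left (a := W) (hXW v hvX)

end PSpace
end

/-! ### The strange curve in characteristic `p` -/

noncomputable section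

/-- An infinite space whose proper closed subsets are finite is irreducible. -/
theorem irreducibleSpace_of_isClosed_finite {T : Type*} [TopologicalSpace T] [Infinite T]
    (h : ∀ Z : Set T, IsClosed Z → Z.Finite ∨ Z = Set.univ) : IrreducibleSpace T := by
  rw [irreducibleSpace_def]
  refine ⟨Set.univ_nonempty, isPreirreducible_iff_isClosed_union_isClosed.2 ?_⟩
  intro Z₁ Z₂ h₁ h₂ hsub
  rcases h Z₁ h₁ with h₁ | h₁
  · rcases h Z₂ h₂ with h₂ | h₂
    · exact absurd ((h₁.union h₂).subset hsub) Set.infinite_univ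
    · exact Or.inr h₂.ge
  · exact Or.inl h₁.ge

/-- An infinite T1 space whose proper closed subsets are finite has dimension one. -/
theorem topologicalKrullDim_eq_one_of_isClosed_finite {T : Type*} [TopologicalSpace T] [T1Space T]
    [Infinite T] (h : ∀ Z : Set T, IsClosed Z → Z.Finite ∨ Z = Set.univ) :
    topologicalKrullDim T = 1 := by
  have hirr := irreducibleSpace_of_isClosed_finite h
  refine le_antisymm (Order.krullDim_le_one_iff.2 fun Z => ?_) (Order.one_le_krullDim_iff.2 ?_)
  -- A finite irreducible subset of a T1 space is a point, hence minimal; otherwise `Z` is the whole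
  -- space, hence maximal.
  · rcases h Z Z.isClosed with hZ | hZ
    · left
      intro W hWZ z hz
      obtain ⟨w, hw⟩ := W.isIrreducible.nonempty
      rwa [hZ.isDiscrete.subsingleton_of_isPreirreducible Z.isIrreducible.isPreirreducible hz
        (hWZ hw)]
    · right
      intro W _ w _
      change w ∈ (Z : Set T)
      rw [hZ]
      trivial
  · obtain ⟨x, y, hxy⟩ := exists_pair_ne T
    refine ⟨{x}, ⟨Set.univ, IrreducibleSpace.isIrreducible_univ T, isClosed_univ⟩,
      lt_of_le_not_ge (fun _ _ => trivial) fun hge => hxy ?_⟩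
    exact (hge (show y ∈ Set.univ from trivial) : y = x).symm

namespace PSpace

variable {K : Type*} [Field K]

instance t1Space (n : ℕ) : T1Space (PSpace K n) := by
  refine ⟨fun p => ?_⟩
  induction p using Projectivization.ind with
  | h v hv =>
    -- The equations are the `2 × 2` minors expressing proportionality to `v`.
    refine isClosed_iff.2 ⟨{f | ∃ i j, f = C (v i) * X j - C (v j) * X i}, ?_, ?_⟩
    · rintro f ⟨i, j, rfl⟩
      refine ⟨1, IsHomogeneous.sub ?_ ?_⟩
      · simpa using (isHomogeneous_C _ (v i)).mul (isHomogeneous_X K j)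
      · simpa using (isHomogeneous_C _ (v j)).mul (isHomogeneous_X K i)
    · ext q
      rw [Set.mem_singleton_iff]
      constructor
      · intro hq f hf
        have hq0 := (Projectivization.mk_eq_mk_iff' K q.rep v q.rep_nonzero hv).1
          (by rw [q.mk_rep, hq])
        obtain ⟨a, ha⟩ := hq0
        obtain ⟨i, j, rfl⟩ := hf
        simp [← ha]
        ring
      · intro hq
        obtain ⟨i, hi⟩ := Function.ne_iff.1 hv
        rw [← q.mk_rep, Projectivization.mk_eq_mk_iff']
        refine ⟨q.rep i / v i, funext fun j => ?_⟩
        have h : v i * q.rep j - v j * q.rep i = 0 := by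
          simpa using hq _ ⟨i, j, rfl⟩
        simp only [Pi.zero_apply] at hi
        simp only [Pi.smul_apply, smul_eq_mul]
        field_simp
        linear_combination -h

/-- The equations of the plane curve `y ^ p = z x ^ (p - 1)` in projective space. -/
def strangeEquations (K : Type*) [Field K] (p : ℕ) : Set (MvPolynomial (Fin (3 + 1)) K) :=
  {X 2 * X 0 ^ (p - 1) - X 1 ^ p, X 3}

/-- The plane curve `y ^ p = z x ^ (p - 1)` in projective space. In characteristic `p` its tangent
lines pass through `[0 : 1 : 0 : 0]`. -/
def strangeCurve (K : Type*) [Field K] (p : ℕ) : Set (PSpace K 3) :=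
  zeros (strangeEquations K p)

variable {p : ℕ}

theorem strangeEquations_isHomogeneous (hp : 2 ≤ p) :
    ∀ f ∈ strangeEquations K p, ∃ d : ℕ, f.IsHomogeneous d := by
  rintro f (rfl | rfl)
  · refine ⟨p, IsHomogeneous.sub ?_ ?_⟩
    · have h := (isHomogeneous_X K (2 : Fin (3 + 1))).mul
        ((isHomogeneous_X K (0 : Fin (3 + 1))).pow (p - 1))
      rwa [show 1 + 1 * (p - 1) = p by omega] at h
    · simpa using (isHomogeneous_X K (1 : Fin (3 + 1))).pow p
  · exact ⟨1, isHomogeneous_X K _⟩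

theorem mk_mem_strangeCurve_iff (hp : 2 ≤ p) (v : Fin (3 + 1) → K) (hv : v ≠ 0) :
    (Projectivization.mk K v hv : PSpace K 3) ∈ strangeCurve K p ↔
      v 2 * v 0 ^ (p - 1) = v 1 ^ p ∧ v 3 = 0 := by
  rw [strangeCurve, mk_mem_zeros_iff (strangeEquations_isHomogeneous hp)]
  simp [strangeEquations, sub_eq_zero]

theorem isClosed_strangeCurve (hp : 2 ≤ p) : IsClosed (strangeCurve K p) :=
  isClosed_iff.2 ⟨_, strangeEquations_isHomogeneous hp, rfl⟩

/-- The points of the affine part of the strange curve. -/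
def strangePoint (p : ℕ) (t : K) : PSpace K 3 :=
  Projectivization.mk K ![1, t, t ^ p, 0] fun h => one_ne_zero (congrFun h 0)

/-- The point at infinity of the strange curve. -/
def strangeInfinity (K : Type*) [Field K] : PSpace K 3 :=
  Projectivization.mk K ![0, 0, 1, 0] fun h => one_ne_zero (congrFun h 2)

theorem strangePoint_mem (hp : 2 ≤ p) (t : K) : strangePoint p t ∈ strangeCurve K p := by
  rw [strangePoint, mk_mem_strangeCurve_iff hp]
  simp

theorem strangeInfinity_mem (hp : 2 ≤ p) : strangeInfinity K ∈ strangeCurve K p := by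
  rw [strangeInfinity, mk_mem_strangeCurve_iff hp]
  simp [show p ≠ 0 by omega, show p - 1 ≠ 0 by omega]

theorem strangePoint_injective : Function.Injective (strangePoint (K := K) p) := by
  intro s t h
  obtain ⟨a, ha⟩ := (Projectivization.mk_eq_mk_iff' K _ _ _ _).1 h
  have h0 := congrFun ha 0
  have h1 := congrFun ha 1
  simp at h0 h1
  simpa [h0] using h1.symm

theorem eq_of_mem_strangeCurve (hp : 2 ≤ p) {x : PSpace K 3} (hx : x ∈ strangeCurve K p) :
    x = strangeInfinity K ∨ ∃ t, x = strangePoint p t := by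
  induction x using Projectivization.ind with
  | h v hv =>
    obtain ⟨h1, h3⟩ := (mk_mem_strangeCurve_iff hp v hv).1 hx
    by_cases h0 : v 0 = 0
    · left
      rw [h0, zero_pow (by omega), mul_zero, eq_comm, pow_eq_zero_iff (by omega)] at h1
      rw [strangeInfinity, Projectivization.mk_eq_mk_iff']
      refine ⟨v 2, funext fun i => ?_⟩
      fin_cases i <;> simp [h0, h1, h3]
    · right
      refine ⟨v 1 / v 0, ?_⟩
      rw [strangePoint, Projectivization.mk_eq_mk_iff']
      refine ⟨v 0, funext fun i => ?_⟩
      have h2 : v 0 * (v 1 / v 0) ^ p = v 2 := by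
        rw [div_pow, ← h1]
        obtain ⟨m, rfl⟩ : ∃ m, p = m + 1 := ⟨p - 1, by omega⟩
        rw [Nat.add_sub_cancel]
        field_simp
        ring
      fin_cases i
      · simp
      · simp
        field_simp
      · simpa using h2
      · simp [h3]

theorem eval_aeval_polynomial {σ : Type*} (g : σ → Polynomial K) (F : MvPolynomial σ K) (s : K) :
    (aeval g F).eval s = eval (fun i => (g i).eval s) F := by
  calc (aeval g F).eval s = ((Polynomial.aeval s).comp (aeval g)) F := by
        rw [AlgHom.comp_apply, Polynomial.coe_aeval_eq_eval]
    _ = eval (fun i => (g i).eval s) F := by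
        rw [comp_aeval, ← coe_aeval_eq_eval]
        rfl

/-- A polynomial that vanishes at infinitely many points of a parametrized curve vanishes at all of
its points. -/
theorem eval_eval_eq_zero_of_infinite {σ : Type*} {F : MvPolynomial σ K} {Z : Set K}
    (hZ : Z.Infinite) (g : σ → Polynomial K) (h : ∀ t ∈ Z, eval (fun i => (g i).eval t) F = 0)
    (t : K) : eval (fun i => (g i).eval t) F = 0 := by
  have h0 : aeval g F = 0 := by
    refine Polynomial.eq_zero_of_infinite_isRoot _ (hZ.mono fun s hs => ?_)
    rw [Set.mem_ofPred_eq, Polynomial.IsRoot.def, eval_aeval_polynomial]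
    exact h s hs
  rw [← eval_aeval_polynomial, h0, Polynomial.eval_zero]

/-- The curve is parametrized by polynomials, and a one-variable polynomial with infinitely many
roots is zero. -/
theorem strangeCurve_subset [Infinite K] (hp : 2 ≤ p) {Z : Set (PSpace K 3)} (hZ : IsClosed Z)
    (hinf : {t : K | strangePoint p t ∈ Z}.Infinite) : strangeCurve K p ⊆ Z := by
  obtain ⟨S, hS, rfl⟩ := isClosed_iff.1 hZ
  have hpt : ∀ F ∈ S, ∀ t : K, eval ![1, t, t ^ p, 0] F = 0 := by
    intro F hF t
    have hvec : ∀ s : K, (fun i => ((![1, Polynomial.X, Polynomial.X ^ p, 0] :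
        Fin (3 + 1) → Polynomial K) i).eval s) = ![1, s, s ^ p, 0] := by
      intro s
      funext i
      fin_cases i <;> simp
    have h := eval_eval_eq_zero_of_infinite (F := F) hinf ![1, Polynomial.X, Polynomial.X ^ p, 0]
      (fun s hs => by
        rw [hvec]
        exact (mk_mem_zeros_iff hS _ _).1 hs F hF) t
    rwa [hvec] at h
  intro x hx
  rcases eq_of_mem_strangeCurve hp hx with rfl | ⟨t, rfl⟩
  · refine (mk_mem_zeros_iff hS _ _).2 fun F hF => ?_
    -- The point at infinity is reached through the chart `s = 1 / t`, whose value at `s = 0` it is.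
    have hvec : ∀ s : K, (fun i => ((![Polynomial.X ^ p, Polynomial.X ^ (p - 1), 1, 0] :
        Fin (3 + 1) → Polynomial K) i).eval s) = ![s ^ p, s ^ (p - 1), 1, 0] := by
      intro s
      funext i
      fin_cases i <;> simp
    have h := eval_eval_eq_zero_of_infinite (F := F) (Set.finite_singleton (0 : K)).infinite_compl
      ![Polynomial.X ^ p, Polynomial.X ^ (p - 1), 1, 0] (fun s hs => by
        have hs0 : s ≠ 0 := hs
        obtain ⟨d, hd⟩ := hS F hF
        have hsm : (![s ^ p, s ^ (p - 1), 1, 0] : Fin (3 + 1) → K) =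
            s ^ p • ![1, s⁻¹, s⁻¹ ^ p, 0] := by
          obtain ⟨m, rfl⟩ : ∃ m, p = m + 1 := ⟨p - 1, by omega⟩
          funext i
          fin_cases i <;> (simp [hs0, pow_succ]; try field_simp)
        rw [hvec, hsm, eval_smul_of_isHomogeneous hd, hpt F hF, mul_zero]) 0
    rw [hvec, zero_pow (by omega), zero_pow (by omega)] at h
    exact h
  · exact (mk_mem_zeros_iff hS _ _).2 fun F hF => hpt F hF t

theorem infinite_strangeCurve [Infinite K] (hp : 2 ≤ p) : Infinite (strangeCurve K p) :=
  Infinite.of_injective (fun t : K => (⟨strangePoint p t, strangePoint_mem hp t⟩ : strangeCurve K p))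
    fun _ _ h => strangePoint_injective (congrArg Subtype.val h)

theorem finite_or_eq_univ_of_isClosed_strangeCurve [Infinite K] (hp : 2 ≤ p)
    (Z : Set (strangeCurve K p)) (hZ : IsClosed Z) : Z.Finite ∨ Z = Set.univ := by
  obtain ⟨T, hT, rfl⟩ := isClosed_induced_iff.1 hZ
  by_cases hfin : {t : K | strangePoint p t ∈ T}.Finite
  · left
    refine Set.Finite.of_finite_image (f := Subtype.val) ?_ Subtype.val_injective.injOn
    refine ((hfin.image (strangePoint p)).insert (strangeInfinity K)).subset ?_
    rintro _ ⟨⟨x, hx⟩, hxT, rfl⟩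
    rcases eq_of_mem_strangeCurve hp hx with rfl | ⟨t, rfl⟩
    · exact Set.mem_insert _ _
    · exact Set.mem_insert_of_mem _ ⟨t, hxT, rfl⟩
  · right
    exact Set.eq_univ_of_forall fun x => strangeCurve_subset hp hT hfin x.2

/-- With the first coordinate fixed, the second one parametrizes the cone. Substituting `v 1 + ε`
moves only that coordinate to first order, because `(v 1 + ε) ^ p = v 1 ^ p` in characteristic `p`.
-/
theorem single_mem_zariskiTangentSpace [Infinite K] [Fact p.Prime] [CharP K p]
    {v : Fin (3 + 1) → K} (hv : v ∈ affineCone (strangeCurve K p)) (hv0 : v 0 ≠ 0) :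
    Pi.single 1 1 ∈ zariskiTangentSpace (affineCone (strangeCurve K p)) v := by
  have hp : 2 ≤ p := (Fact.out : p.Prime).two_le
  have hvne : v ≠ 0 := fun h => hv0 (congrFun h 0)
  obtain ⟨h1, h3⟩ := (mk_mem_strangeCurve_iff hp v hvne).1 (hv hvne)
  intro f hf
  rw [← snd_expansion]
  let g : Fin (3 + 1) → Polynomial K :=
    ![Polynomial.C (v 0), Polynomial.X, Polynomial.C (v 0 ^ (p - 1))⁻¹ * Polynomial.X ^ p, 0]
  have hg : aeval g f = 0 := by
    refine Polynomial.funext fun t => ?_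
    rw [Polynomial.eval_zero, eval_aeval_polynomial]
    refine hf _ fun hne => (mk_mem_strangeCurve_iff hp _ hne).2 ?_
    simp [g]
    field_simp
  have hchar : CharP (DualNumber K) p :=
    charP_of_injective_algebraMap (algebraMap K (DualNumber K)).injective p
  have hcomp : (Polynomial.aeval (TrivSqZeroExt.inl (v 1) + DualNumber.eps : DualNumber K)).comp
      (aeval g) = expansion v (Pi.single 1 1) := by
    refine algHom_ext fun i => ?_
    have hpow : (TrivSqZeroExt.inl (v 1) + DualNumber.eps : DualNumber K) ^ p =
        TrivSqZeroExt.inl (v 1 ^ p) := by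
      rw [add_pow_char, pow_eq_zero_of_le (a := DualNumber.eps) hp DualNumber.eps_pow_two, add_zero, TrivSqZeroExt.inl_pow]
    fin_cases i
    · simp [g, expansion, TrivSqZeroExt.algebraMap_eq_inl]
    · simp [g, expansion]
    · have h2 : (v 0 ^ (p - 1))⁻¹ * v 1 ^ p = v 2 := by
        rw [← h1]
        field_simp
      simp only [g, expansion, Fin.reduceFinMk, AlgHom.comp_apply, aeval_X, Matrix.cons_val,
        map_mul, map_pow, Polynomial.aeval_C, Polynomial.aeval_X, hpow,
        TrivSqZeroExt.algebraMap_eq_inl]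
      rw [← TrivSqZeroExt.inl_mul, h2]
      simp
    · simp [g, expansion, h3]
  rw [← hcomp, AlgHom.comp_apply, hg, map_zero, TrivSqZeroExt.snd_zero]

theorem exists_strange_curve (K : Type*) [Field K] [IsAlgClosed K] (p : ℕ) [hpf : Fact p.Prime]
    [CharP K p] :
    ∃ (X : Set (PSpace K 3)) (L : Projectivization.Subspace K (Fin (3 + 1) → K)),
      IsClosed X ∧ IsIrreducible X ∧ topologicalKrullDim X = 1 ∧ linDim L = 0 ∧
      (∃ U : Set (PSpace K 3), IsOpen U ∧ X ⊆ closure (X ∩ U) ∧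
        ∀ q ∈ X ∩ U, 0 ≤ linDim (L ⊓ embeddedTangentSpace X q)) ∧
      ¬ ∃ M : Projectivization.Subspace K (Fin (3 + 1) → K),
        linDim M = 1 ∧ L ≤ M ∧ X ⊆ (M : Set (PSpace K 3)) := by
  have hp : 2 ≤ p := hpf.out.two_le
  have hinfK : Infinite K := IsAlgClosed.instInfinite
  have hinf := infinite_strangeCurve (K := K) hp
  have hfin := finite_or_eq_univ_of_isClosed_strangeCurve (K := K) hp
  have hirr : IsIrreducible (strangeCurve K p) :=
    isIrreducible_iff_irreducibleSpace.2 (irreducibleSpace_of_isClosed_finite hfin)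
  have he1 : (Pi.single 1 1 : Fin (3 + 1) → K) ≠ 0 := fun h => by
    simpa using congrFun h 1
  refine ⟨strangeCurve K p, Projectivization.Subspace.submodule.symm
    (Submodule.span K {Pi.single 1 1}), isClosed_strangeCurve hp, hirr,
    topologicalKrullDim_eq_one_of_isClosed_finite hfin, ?_,
    ⟨(zeros {X 0})ᶜ, (isClosed_zeros_singleton (isHomogeneous_X K 0)).isOpen_compl, ?_, ?_⟩, ?_⟩
  · rw [linDim, OrderIso.apply_symm_apply, finrank_span_singleton he1]
    simp
  · refine subset_closure_inter_of_isPreirreducible_of_isOpen hirr.isPreirreducible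
      (isClosed_zeros_singleton (isHomogeneous_X K 0)).isOpen_compl
      ⟨strangePoint p 0, strangePoint_mem hp 0, ?_⟩
    rw [Set.mem_compl_iff, strangePoint, mk_mem_zeros_singleton_iff (isHomogeneous_X K 0)]
    simp
  · rintro q ⟨hq, hqU⟩
    induction q using Projectivization.ind with
    | h v hv =>
      rw [Set.mem_compl_iff, mk_mem_zeros_singleton_iff (isHomogeneous_X K 0), eval_X] at hqU
      have hmem := single_mem_zariskiTangentSpace (fun _ => hq) hqU
      rw [embeddedTangentSpace_mk, linDim, submodule_inf_symm, OrderIso.apply_symm_apply, inf_eq_left.2 (by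
          rwa [Submodule.span_singleton_le_iff_mem]), finrank_span_singleton he1]
      simp
  · rintro ⟨M, hM, hLM, hXM⟩
    set W := Projectivization.Subspace.submodule M with hW
    have hrank : Module.finrank K W = 2 := by
      have h : (Module.finrank K W : ℤ) - 1 = 1 := hM
      omega
    -- Three independent vectors lie in `W`, which has rank two: the first is the curve point `t =
    -- 0`, the second is `L`, the third is the point at infinity.
    have hmem : ∀ i : Fin 3, Pi.single i.castSucc 1 ∈ W := by
      intro i
      fin_cases i
      · have h : strangePoint p (0 : K) ∈ M := hXM (strangePoint_mem hp 0)
        rw [strangePoint, ← Projectivization.Subspace.mem_submodule_iff] at h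
        convert! h using 1
        funext j
        fin_cases j <;> simp [show p ≠ 0 by omega]
      · rw [OrderIso.symm_apply_le] at hLM
        exact hLM (Submodule.mem_span_singleton_self _)
      · have h : strangeInfinity K ∈ M := hXM (strangeInfinity_mem hp)
        rw [strangeInfinity, ← Projectivization.Subspace.mem_submodule_iff] at h
        convert! h using 1
        funext j
        fin_cases j <;> simp
    have hli : LinearIndependent K (fun i : Fin 3 => (⟨_, hmem i⟩ : W)) := by
      refine LinearIndependent.of_comp W.subtype ?_
      have h := (Pi.basisFun K (Fin (3 + 1))).linearIndependent.comp (Fin.castSucc : Fin 3 → _)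
        (Fin.castSucc_injective 3)
      convert! h using 1
      funext i
      simp
    have hcard := hli.fintype_card_le_finrank
    rw [hrank, Fintype.card_fin] at hcard
    omega

end PSpace
end

theorem mainTheorem6 {K : Type*} [Field K] [IsAlgClosed K] :
    (CharZero K →
      ∀ (n r k : ℕ) (X : Set (PSpace K n))
        (L : Projectivization.Subspace K (Fin (n + 1) → K)),
        k < n →
        IsClosed X → IsIrreducible X → topologicalKrullDim X = (r : WithBot ℕ∞) →
        PSpace.linDim L = (k : ℤ) →
        (∃ U : Set (PSpace K n), IsOpen U ∧ X ⊆ closure (X ∩ U) ∧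
          ∀ p ∈ X ∩ U, (r : ℤ) - 1 ≤ PSpace.linDim (L ⊓ PSpace.embeddedTangentSpace X p)) →
        ∃ M : Projectivization.Subspace K (Fin (n + 1) → K),
          PSpace.linDim M = (k : ℤ) + 1 ∧ L ≤ M ∧ X ⊆ (M : Set (PSpace K n))) ∧
    (∀ p : ℕ, p.Prime → CharP K p →
      ∃ (X : Set (PSpace K 3)) (L : Projectivization.Subspace K (Fin (3 + 1) → K)),
        IsClosed X ∧ IsIrreducible X ∧ topologicalKrullDim X = 1 ∧ PSpace.linDim L = 0 ∧
        (∃ U : Set (PSpace K 3), IsOpen U ∧ X ⊆ closure (X ∩ U) ∧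
          ∀ q ∈ X ∩ U, 0 ≤ PSpace.linDim (L ⊓ PSpace.embeddedTangentSpace X q)) ∧
        ¬ ∃ M : Projectivization.Subspace K (Fin (3 + 1) → K),
          PSpace.linDim M = 1 ∧ L ≤ M ∧ X ⊆ (M : Set (PSpace K 3))) := by
  refine ⟨?_, ?_⟩
  · rintro hchar n r k X L hk hXc hX hdim hL ⟨U, hU, hdense, htan⟩
    refine PSpace.exists_subspace_of_le_linDim_tangent hk hXc hX hdim.le hL hU ?_ htan
    -- Density is used only to make `X ∩ U` nonempty.
    exact closure_nonempty_iff.1 (hX.nonempty.mono hdense)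
  · intro p hp hchar
    have : Fact p.Prime := ⟨hp⟩
    exact PSpace.exists_strange_curve K p
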